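/- Let $G$ be a group. For $g,h\in G$, a subset $E\subseteq G$ is called a weak Sierpiński subset with respect to $(g,h)$ if there are elements $a\neq b$ of $E$ with $gE=E\smallsetminus\{a\}$ and $hE=E\smallsetminus\{b\}$; it is called a weak Sierpiński subset if this holds for some $g,h\in G$. (i) If $G$ contains a weak Sierpiński subset, then $G$ contains a free subgroup of rank two. (ii) More precisely, if $G$ contains a weak Sierpiński subset with respect to $(g,h)$, then $(g,\,h^{-1}gh)$ is a free pair in the subgroup $H=\langle g,h\rangle$; that is, the homomorphism from the free group on two letters $x,y$ to $H$ with $x\mapsto g$ and $y\mapsto h^{-1}gh$ is injective. -/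

import Mathlib

open scoped Pointwise

/-- `E` is a weak Sierpiński subset of `G` with respect to `g` and `h`: there are distinct points
`a, b` of `E` with `gE = E ∖ {a}` and `hE = E ∖ {b}`. Here `g • E` is the left translate `gE`. -/
def IsWeakSierpinskiWith {G : Type*} [Group G] (g h : G) (E : Set G) : Prop :=
  ∃ a ∈ E, ∃ b ∈ E, a ≠ b ∧ g • E = E \ {a} ∧ h • E = E \ {b}

/-- `E` is a weak Sierpiński subset of `G`. -/
def IsWeakSierpinski {G : Type*} [Group G] (E : Set G) : Prop :=
  ∃ g h : G, IsWeakSierpinskiWith g h E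

/-- `(x, y)` is a free pair: the homomorphism from the free group on two letters that sends the
letters to `x` and `y` is injective, so `x` and `y` freely generate the subgroup `⟨x, y⟩`. -/
def IsFreePair {G : Type*} [Group G] (x y : G) : Prop :=
  Function.Injective (FreeGroup.lift (![x, y] : Fin 2 → G))

/-- A subgroup that is free of rank two. -/
def IsFreeOfRankTwo {G : Type*} [Group G] (F : Subgroup G) : Prop :=
  Nonempty (F ≃* FreeGroup (Fin 2))

/-- The first generator `g`, as an element of the subgroup `⟨g, h⟩`. -/
def fstGen {G : Type*} [Group G] (g h : G) : Subgroup.closure ({g, h} : Set G) :=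
  ⟨g, Subgroup.subset_closure (Set.mem_insert g {h})⟩

/-- The second generator `h`, as an element of the subgroup `⟨g, h⟩`. -/
def sndGen {G : Type*} [Group G] (g h : G) : Subgroup.closure ({g, h} : Set G) :=
  ⟨h, Subgroup.subset_closure (Set.mem_insert_of_mem g (Set.mem_singleton h))⟩

/-!
Replacing `E` by `F = {x | x⁻¹a ∈ E}` turns left translations into right ones: in the right Cayley
graph of `⟨g, h⟩`, exactly one `g`-edge and at most one `h`-edge leave `F`, and no edge enters it.

If no `h`-edge leaves `F`, then `F` is invariant under `h`, and translates of `F` and of its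
complement by powers of `h` play ping-pong for the conjugates of `g` by powers of `h`.

Otherwise the translates of `F` put every edge of the graph into an edge cut of size two.
Intersecting such cuts, one shortens the distance between the two edges of a cut until both start
at the same vertex, say `1`. Now consider the `ℤ[G]`-module of finitely supported coboundaries of
integer functions on the graph. It contains the coboundary of the short cut, that of `F` and that
of the point `1`, and it is closed under division by `1 - u` for `u` of infinite order. From these
one obtains a height function that drops by one along the `g`-edge at `1` and changes along no
other edge, except possibly by the same amount along the `h`-edge at `1`. Its superlevel set is
then invariant under `h`, respectively under `h⁻¹g`, and plays ping-pong as before.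
-/

section EdgeBoundary

variable {V : Type*} {Γ : SimpleGraph V} {A B : Set V}

/-- The outgoing edge boundary of a set `A` of vertices: the edges of `Γ` that leave `A`, each
oriented from its end in `A` to its end outside `A`. -/
def outBoundary (Γ : SimpleGraph V) (A : Set V) : Set (V × V) :=
  {e | e.1 ∈ A ∧ e.2 ∉ A ∧ Γ.Adj e.1 e.2}

theorem mem_outBoundary {x y : V} : (x, y) ∈ outBoundary Γ A ↔ x ∈ A ∧ y ∉ A ∧ Γ.Adj x y :=
  Iff.rfl

theorem swap_mem_outBoundary_compl {x y : V} :
    (y, x) ∈ outBoundary Γ Aᶜ ↔ (x, y) ∈ outBoundary Γ A := by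
  simp only [mem_outBoundary, Set.mem_compl_iff, not_not, Γ.adj_comm y x]
  tauto

theorem outBoundary_compl_eq_pair {p p' q q' : V} (hA : outBoundary Γ A = {(p, p'), (q, q')}) :
    outBoundary Γ Aᶜ = {(p', p), (q', q)} := by
  ext ⟨x, y⟩
  rw [swap_mem_outBoundary_compl, hA]
  simp [and_comm]

theorem outBoundary_compl_eq_singleton {p p' : V} (hA : outBoundary Γ A = {(p, p')}) :
    outBoundary Γ Aᶜ = {(p', p)} := by
  rw [← Set.pair_eq_singleton] at hA
  simpa using outBoundary_compl_eq_pair hA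

theorem eq_empty_of_outBoundary_eq_empty (hΓ : Γ.Connected) (hA : outBoundary Γ A = ∅) {z : V}
    (hz : z ∉ A) : A = ∅ := by
  refine Set.eq_empty_iff_forall_notMem.2 fun x hx => ?_
  obtain ⟨w⟩ := hΓ x z
  obtain ⟨e, -, he, he'⟩ := w.exists_boundary_dart A hx hz
  exact hA.subset (show e.toProd ∈ outBoundary Γ A from ⟨he, he', e.adj⟩)

theorem disjoint_of_outBoundary_eq_singleton (hΓ : Γ.Connected) {x x' y y' : V}
    (hA : outBoundary Γ A = {(x, x')}) (hB : outBoundary Γ B = {(y, y')})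
    (hxB : x' ∉ B) (hyA : y' ∉ A) (hne : (x, x') ≠ (y, y')) : Disjoint A B := by
  have hx : (x, x') ∈ outBoundary Γ A := hA ▸ rfl
  refine Set.disjoint_iff_inter_eq_empty.2 (eq_empty_of_outBoundary_eq_empty hΓ (z := x') ?_
    fun h => hx.2.1 h.1)
  refine Set.eq_empty_iff_forall_notMem.2 fun ⟨u, v⟩ ⟨⟨huA, huB⟩, hv, huv⟩ => ?_
  have hvA : v ∉ A → (u, v) = (x, x') := fun h => hA.subset ⟨huA, h, huv⟩
  have hvB : v ∉ B → (u, v) = (y, y') := fun h => hB.subset ⟨huB, h, huv⟩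
  grind

theorem exists_adj_crossing (hΓ : Γ.Connected) {x q : V} (w : Γ.Walk x q) (hx : x ∉ B)
    (hq : q ∈ B) :
    ∃ b b', b ∉ B ∧ b' ∈ B ∧ Γ.Adj b b' ∧ Γ.dist x b + 1 + Γ.dist b' q ≤ w.length := by
  induction w with
  | nil => exact absurd hq hx
  | @cons x y q hxy w ih =>
    rw [SimpleGraph.Walk.length_cons]
    by_cases hy : y ∈ B
    · refine ⟨x, y, hx, hy, hxy, ?_⟩
      have := Γ.dist_le w
      rw [SimpleGraph.dist_self]
      lia
    · obtain ⟨b, b', hb, hb', hbb', hle⟩ := ih hy hq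
      have hxb : Γ.dist x b ≤ Γ.dist x y + Γ.dist y b := hΓ.dist_triangle
      rw [SimpleGraph.dist_eq_one_iff_adj.2 hxy] at hxb
      exact ⟨b, b', hb, hb', hbb', by lia⟩

theorem exists_adj_dist_add_one_eq (hΓ : Γ.Connected) {p q : V} (hpq : p ≠ q) :
    ∃ p₁, Γ.Adj p p₁ ∧ Γ.dist p₁ q + 1 = Γ.dist p q := by
  obtain ⟨w, hw⟩ := hΓ.exists_walk_length_eq_dist p q
  cases w with
  | nil => exact absurd rfl hpq
  | @cons _ p₁ _ hadj w =>
    have h₁ := Γ.dist_le w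
    have h₂ : Γ.dist p q ≤ Γ.dist p p₁ + Γ.dist p₁ q := hΓ.dist_triangle
    rw [SimpleGraph.dist_eq_one_iff_adj.2 hadj] at h₂
    rw [SimpleGraph.Walk.length_cons] at hw
    exact ⟨p₁, hadj, by lia⟩

theorem dist_lt_of_outBoundary_eq_pair (hΓ : Γ.Connected) {p p₁ q r r₁ : V}
    (hB : outBoundary Γ B = {(p, p₁), (r, r₁)}) (hq : q ∈ B)
    (hdist : Γ.dist p₁ q + 1 = Γ.dist p q) : Γ.dist p₁ r₁ < Γ.dist p q := by
  have hp : (p, p₁) ∈ outBoundary Γ B := hB ▸ Or.inl rfl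
  obtain ⟨w, hw⟩ := hΓ.exists_walk_length_eq_dist p₁ q
  obtain ⟨b, b', hb, hb', hadj, hle⟩ := exists_adj_crossing hΓ w hp.2.1 hq
  have hcross : (b', b) ∈ outBoundary Γ B := ⟨hb', hb, hadj.symm⟩
  rw [hB] at hcross
  obtain h | h := hcross <;> cases h <;> lia

theorem outBoundary_inter_eq_pair {p p' p₁ q q' r r₁ : V}
    (hA : outBoundary Γ A = {(p, p'), (q, q')}) (hB : outBoundary Γ B = {(p, p₁), (r, r₁)})
    (hq : q ∉ B) (hr : r ∉ A) : outBoundary Γ (A ∩ B) = {(p, p'), (p, p₁)} := by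
  have hpA : (p, p') ∈ outBoundary Γ A := hA ▸ Or.inl rfl
  have hpB : (p, p₁) ∈ outBoundary Γ B := hB ▸ Or.inl rfl
  simp only [Set.ext_iff, Prod.forall, mem_outBoundary, Set.mem_insert_iff, Set.mem_singleton_iff,
    Prod.mk.injEq, Set.mem_inter_iff] at *
  grind

theorem outBoundary_diff_eq_singleton {p p' p₁ q q' r r₁ : V}
    (hA : outBoundary Γ A = {(p, p'), (q, q')}) (hB : outBoundary Γ B = {(p, p₁), (r, r₁)})
    (hq : q ∉ B) (hr : r ∈ A) (hp' : p' ∈ B) : outBoundary Γ (B \ A) = {(p', p)} := by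
  simp only [Set.ext_iff, Prod.forall, mem_outBoundary, Set.mem_insert_iff, Set.mem_singleton_iff,
    Prod.mk.injEq, Set.mem_sdiff] at *
  have := fun x y => Γ.adj_comm x y
  grind

theorem exists_outBoundary_eq_singleton_prod_pair (hΓ : Γ.Connected)
    (hcut : ∀ x y, Γ.Adj x y → ∃ B z z', outBoundary Γ B = {(x, y), (z, z')}) {p p' q q' : V}
    (hA : outBoundary Γ A = {(p, p'), (q, q')}) :
    ∃ B x y z, outBoundary Γ B = {x} ×ˢ {y, z} := by
  simp only [Set.singleton_prod, Set.image_pair]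
  induction hn : Γ.dist p q using Nat.strong_induction_on generalizing A p p' q q' with
  | _ n ih =>
  subst hn
  have closer {B : Set V} {p₁ r r₁ : V} (hB : outBoundary Γ B = {(p, p₁), (r, r₁)}) (hq : q ∈ B)
      (hdist : Γ.dist p₁ q + 1 = Γ.dist p q) : ∃ B x y z, outBoundary Γ B = {(x, y), (x, z)} :=
    ih _ (dist_lt_of_outBoundary_eq_pair hΓ hB hq hdist) (outBoundary_compl_eq_pair hB) rfl
  obtain rfl | hpq := eq_or_ne p q
  · exact ⟨A, p, p', q', hA⟩
  have hpA : (p, p') ∈ outBoundary Γ A := hA ▸ Or.inl rfl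
  have hqA : (q, q') ∈ outBoundary Γ A := hA ▸ Or.inr rfl
  obtain ⟨p₁, hadj, hdist⟩ := exists_adj_dist_add_one_eq hΓ hpq
  obtain rfl | hp₁ := eq_or_ne p₁ p'
  · exact closer hA hqA.1 hdist
  obtain ⟨B, r, r₁, hB⟩ := hcut p p₁ hadj
  by_cases hq : q ∈ B
  · exact closer hB hq hdist
  obtain rfl | hrp := eq_or_ne r p
  · exact ⟨B, r, p₁, r₁, hB⟩
  by_cases hr : r ∈ A
  · have hpB : (p, p₁) ∈ outBoundary Γ B := hB ▸ Or.inl rfl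
    have hp' : p' ∈ B := by
      by_contra hp'
      have : (p, p') ∈ outBoundary Γ B := ⟨hpB.1, hp', hpA.2.2⟩
      rw [hB] at this
      grind
    refine ⟨B \ A, p', p, p, ?_⟩
    rw [outBoundary_diff_eq_singleton hA hB hq hr hp', Set.pair_eq_singleton]
  · exact ⟨A ∩ B, p, p', p₁, outBoundary_inter_eq_pair hA hB hq hr⟩

end EdgeBoundary

section CayleyGraph

open SimpleGraph (mulCayley)

variable {G : Type*} [Group G] {S : Set G}

theorem mulCayley_connected (hS : Subgroup.closure S = ⊤) : (mulCayley S).Connected := by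
  have step (x : G) {s : G} (hs : s ∈ S) : (mulCayley S).Reachable x (x * s) := by
    obtain h | h := eq_or_ne x (x * s)
    · exact h ▸ .rfl
    · exact SimpleGraph.Adj.reachable <|
        (SimpleGraph.mulCayley_adj' S x (x * s)).2 ⟨h, s, hs, Or.inl rfl⟩
  have reach (x : G) : (mulCayley S).Reachable 1 x := by
    induction hS ▸ Subgroup.mem_top x using Subgroup.closure_induction_right with
    | one => exact .rfl
    | mul_right x _ s hs ih => exact ih.trans (step x hs)
    | mul_inv_cancel x _ s hs ih => exact ih.trans (by simpa using (step (x * s⁻¹) hs).symm)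
  exact ⟨fun x y => (reach x).symm.trans (reach y)⟩

theorem mem_outBoundary_mulCayley {A : Set G} {x y : G} :
    (x, y) ∈ outBoundary (mulCayley S) A ↔
      x ∈ A ∧ y ∉ A ∧ ∃ s ∈ S, x * s = y ∨ x = y * s := by
  simp only [mem_outBoundary, SimpleGraph.mulCayley_adj']
  grind

theorem outBoundary_mulCayley_smul (u : G) (A : Set G) :
    outBoundary (mulCayley S) (u • A) = u • outBoundary (mulCayley S) A := by
  ext ⟨x, y⟩
  simp [Set.mem_smul_set_iff_inv_smul_mem, mem_outBoundary]

theorem mem_outBoundary_mulCayley_of_mul_mem {A : Set G} (hA : ∀ s ∈ S, ∀ x, x * s ∈ A → x ∈ A)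
    {x y : G} : (x, y) ∈ outBoundary (mulCayley S) A ↔
      x ∈ A ∧ y ∉ A ∧ ∃ s ∈ S, x * s = y := by
  rw [mem_outBoundary_mulCayley]
  refine and_congr_right fun hx => and_congr_right fun hy => exists_congr fun s =>
    and_congr_right fun hs => or_iff_left ?_
  rintro rfl
  exact hy (hA s hs y hx)

theorem exists_outBoundary_mulCayley_eq_one_prod_pair (hS : Subgroup.closure S = ⊤)
    (hne : S.Nonempty)
    (hcut : ∀ s ∈ S, ∃ B x z z', outBoundary (mulCayley S) B = {(x, x * s), (z, z')}) :
    ∃ B s t, outBoundary (mulCayley S) B = {1} ×ˢ {s, t} := by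
  have hcut_edge {s : G} (hs : s ∈ S) (x : G) :
      ∃ B z z', outBoundary (mulCayley S) B = {(x, x * s), (z, z')} := by
    obtain ⟨B, y, z, z', hB⟩ := hcut s hs
    exact ⟨(x * y⁻¹) • B, x * y⁻¹ * z, x * y⁻¹ * z', by
      simp [outBoundary_mulCayley_smul, hB, Set.smul_set_insert, ← mul_assoc]⟩
  have hcut_adj (x y : G) (hxy : (mulCayley S).Adj x y) :
      ∃ B z z', outBoundary (mulCayley S) B = {(x, y), (z, z')} := by
    obtain ⟨-, s, hs, rfl | rfl⟩ := (SimpleGraph.mulCayley_adj' S x y).1 hxy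
    · exact hcut_edge hs x
    · obtain ⟨B, z, z', hB⟩ := hcut_edge hs y
      exact ⟨Bᶜ, z', z, outBoundary_compl_eq_pair hB⟩
  obtain ⟨s, hs⟩ := hne
  obtain ⟨A, z, z', hA⟩ := hcut_edge hs 1
  obtain ⟨B, x, s, t, hB⟩ :=
    exists_outBoundary_eq_singleton_prod_pair (mulCayley_connected hS) hcut_adj hA
  refine ⟨x⁻¹ • B, x⁻¹ * s, x⁻¹ * t, ?_⟩
  simp [outBoundary_mulCayley_smul, hB, Set.smul_set_insert, Set.singleton_prod, Set.image_pair]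

theorem outBoundary_mulCayley_insert {g : G} {Y : Set G} (h₁ : 1 ∈ Y)
    (hg : ∀ x, x * g ∈ Y ↔ x ∈ Y ∧ x ≠ 1) (hS : ∀ s ∈ S, ∀ x, x * s ∈ Y ↔ x ∈ Y) :
    outBoundary (mulCayley (insert g S)) Y = {(1, g)} := by
  ext ⟨x, y⟩
  rw [mem_outBoundary_mulCayley_of_mul_mem, Set.mem_singleton_iff, Prod.mk.injEq]
  · constructor
    · rintro ⟨hx, hy, s, rfl | hs, rfl⟩
      · obtain rfl : x = 1 := by simpa [hg, hx] using hy
        simp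
      · exact absurd ((hS s hs x).2 hx) hy
    · rintro ⟨rfl, rfl⟩
      exact ⟨h₁, by simpa using hg 1, y, Set.mem_insert y S, one_mul y⟩
  · rintro s (rfl | hs) x hx
    · exact ((hg x).1 hx).1
    · exact (hS s hs x).1 hx

theorem injective_lift_conj {g : G} {K : Subgroup G} [Nontrivial K] {Y : Set G}
    (hgen : Subgroup.closure (insert g (K : Set G)) = ⊤) (h₁ : 1 ∈ Y)
    (hg : ∀ x, x * g ∈ Y ↔ x ∈ Y ∧ x ≠ 1) (hK : ∀ k ∈ K, ∀ x, x * k ∈ Y ↔ x ∈ Y) :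
    Function.Injective (FreeGroup.lift fun k : K => (k : G) * g * (k : G)⁻¹) := by
  have hΓ := mulCayley_connected hgen
  have mem_Y {k : G} (hk : k ∈ K) : k ∈ Y := by simpa [h₁] using hK k hk 1
  have mul_notMem_Y {k : G} (hk : k ∈ K) : g * k ∉ Y := by simpa [hK k hk g] using hg 1
  have inv_mem_Y : g⁻¹ ∈ Y := ((hg g⁻¹).1 (by simpa using h₁)).1
  have hY := outBoundary_mulCayley_insert h₁ hg hK
  have hX (k : K) : outBoundary (mulCayley (insert g (K : Set G))) ((k : G) • Yᶜ) =
      {((k : G) * g, (k : G))} := by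
    simp [outBoundary_mulCayley_smul, outBoundary_compl_eq_singleton hY]
  have hZ (k : K) : outBoundary (mulCayley (insert g (K : Set G)))
      ((k * g⁻¹ : G) • Y) = {((k : G) * g⁻¹, (k : G))} := by
    simp [outBoundary_mulCayley_smul, hY]
  have notMem_X (k l : K) : (k : G) ∉ (l : G) • Yᶜ := by
    simpa [Set.mem_smul_set_iff_inv_smul_mem] using mem_Y (l⁻¹ * k).2
  have notMem_Z (k l : K) : (k : G) ∉ (l * g⁻¹ : G) • Y := by
    simpa [Set.mem_smul_set_iff_inv_smul_mem, mul_assoc] using mul_notMem_Y (l⁻¹ * k).2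
  have hgg : g ≠ g⁻¹ := fun h => mul_notMem_Y K.one_mem (by rwa [mul_one, h])
  refine FreeGroup.injective_lift_of_ping_pong (α := G) _ (fun k : K => (k : G) • Yᶜ)
    (fun k : K => (k * g⁻¹ : G) • Y) (fun k => ?_) (fun k l hkl => ?_) (fun k l hkl => ?_)
    (fun k l => ?_) (fun k => ?_) (fun k => ?_)
  · exact Set.Nonempty.smul_set ⟨g, by simpa using mul_notMem_Y K.one_mem⟩
  · exact disjoint_of_outBoundary_eq_singleton hΓ (hX k) (hX l) (notMem_X k l) (notMem_X l k)
      (by simpa using hkl)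
  · exact disjoint_of_outBoundary_eq_singleton hΓ (hZ k) (hZ l) (notMem_Z k l) (notMem_Z l k)
      (by simpa using hkl)
  · exact disjoint_of_outBoundary_eq_singleton hΓ (hX k) (hZ l) (notMem_Z k l) (notMem_X l k)
      fun h => hgg <| by
        obtain ⟨h, hkl⟩ := Prod.mk.inj h
        exact mul_left_cancel (hkl ▸ h)
  · simp [← Set.smul_set_compl, smul_smul]
  · simp [← Set.smul_set_compl, smul_smul, mul_assoc]

end CayleyGraph

section Coboundaries

open Filter MonoidAlgebra
open SimpleGraph (mulCayley)

variable {G ι : Type*} [Group G]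

/-- The finitely supported coboundaries on the right Cayley graph of `G` with generators `s i`:
families `w` for which some `m : G → ℤ` drops by `w i x` along every edge `x → x * s i`. The
function `m` need not be finitely supported, but each `w i` is. Left translation of `m` makes them
a `ℤ[G]`-module. -/
def coboundaries (s : ι → G) : Submodule ℤ[G] (ι → ℤ[G]) where
  carrier := {w | ∃ m : G → ℤ, ∀ i x, m x - m (x * s i) = (w i).coeff x}
  add_mem' := by
    rintro v w ⟨m, hm⟩ ⟨n, hn⟩
    refine ⟨m + n, fun i x => ?_⟩
    simp only [Pi.add_apply, coeff_add, Finsupp.add_apply, ← hm, ← hn]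
    ring
  zero_mem' := ⟨0, fun i x => by simp⟩
  smul_mem' := by
    rintro c w ⟨m, hm⟩
    refine ⟨fun x => c.coeff.sum fun u n => n * m (u⁻¹ * x), fun i x => ?_⟩
    simp only [Pi.smul_apply, smul_eq_mul, coeff_mul_apply_left, ← hm, mul_sub, ← mul_assoc]
    rw [Finsupp.sum_sub]

theorem tendsto_pow_mul_cofinite {u : G} (hu : ¬IsOfFinOrder u) (x : G) :
    Tendsto (fun n : ℕ => u ^ n * x) atTop cofinite := by
  rw [← Nat.cofinite_eq_atTop]
  exact ((mul_left_injective x).comp (injective_pow_iff_not_isOfFinOrder.2 hu)).tendsto_cofinite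

theorem eventually_coeff_pow_mul_eq_zero {u : G} (hu : ¬IsOfFinOrder u) (w : ℤ[G]) (x : G) :
    ∀ᶠ n : ℕ in atTop, w.coeff (u ^ n * x) = 0 :=
  ((tendsto_pow_mul_cofinite hu x).eventually w.coeff.hasFiniteSupport.compl_mem_cofinite).mono
    fun _ => Function.notMem_support.1

theorem exists_eventually_pow_mul_eq {s : ι → G} (hs : Subgroup.closure (Set.range s) = ⊤) {u : G}
    (hu : ¬IsOfFinOrder u) {w : ι → ℤ[G]} {m : G → ℤ}
    (hm : ∀ i x, m x - m (x * s i) = (w i).coeff x) :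
    ∃ L, ∀ x, ∀ᶠ n : ℕ in atTop, m (u ^ n * x) = L := by
  have step (i : ι) (x : G) : ∀ᶠ n : ℕ in atTop, m (u ^ n * (x * s i)) = m (u ^ n * x) := by
    filter_upwards [eventually_coeff_pow_mul_eq_zero hu (w i) x] with n hn
    rw [← mul_assoc, eq_comm, ← sub_eq_zero, hm, hn]
  have const (x : G) : ∀ᶠ n : ℕ in atTop, m (u ^ n * x) = m (u ^ n) := by
    induction hs ▸ Subgroup.mem_top x using Subgroup.closure_induction_right with
    | one => simp
    | mul_right x _ _ hi ih =>
      obtain ⟨i, rfl⟩ := hi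
      filter_upwards [ih, step i x] with n h₁ h₂ using h₂.trans h₁
    | mul_inv_cancel x _ _ hi ih =>
      obtain ⟨i, rfl⟩ := hi
      filter_upwards [ih, step i (x * (s i)⁻¹)] with n h₁ h₂
      rwa [← h₂, inv_mul_cancel_right]
  obtain ⟨N, hN⟩ := eventually_atTop.1 (const u)
  have hL (n : ℕ) (hn : N ≤ n) : m (u ^ n) = m (u ^ N) := by
    induction n, hn using Nat.le_induction with
    | base => rfl
    | succ n hn ih => rw [pow_succ, hN n hn, ih]
  refine ⟨m (u ^ N), fun x => ?_⟩
  filter_upwards [const x, eventually_ge_atTop N] with n hx hn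
  rw [hx, hL n hn]

theorem mem_coboundaries_of_one_sub_smul_mem {s : ι → G}
    (hs : Subgroup.closure (Set.range s) = ⊤) {u : G} (hu : ¬IsOfFinOrder u) {w : ι → ℤ[G]}
    (hw : (1 - of ℤ G u) • w ∈ coboundaries s) : w ∈ coboundaries s := by
  obtain ⟨m, hm⟩ := hw
  obtain ⟨L, hL⟩ := exists_eventually_pow_mul_eq hs hu hm
  have sum_const (x : G) :
      ∃ c, ∀ᶠ n in atTop, ∑ i ∈ Finset.range n, (L - m (u ^ (i + 1) * x)) = c := by
    obtain ⟨N, hN⟩ := eventually_atTop.1 (hL x)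
    refine ⟨_, eventually_atTop.2 ⟨N, fun n hn => Finset.eventually_constant_sum ?_ hn⟩⟩
    exact fun i hi => by rw [hN (i + 1) (by lia), sub_self]
  -- Dividing `m` by `1 - u` means summing it over the orbits of `u`; this sum telescopes.
  choose M hM using sum_const
  refine ⟨M, fun i x => ?_⟩
  obtain ⟨n, hx, hxs, hn⟩ := ((hM x).and ((hM (x * s i)).and
    (eventually_coeff_pow_mul_eq_zero hu (w i) x))).exists
  have hterm (k : ℕ) : (L - m (u ^ (k + 1) * x)) - (L - m (u ^ (k + 1) * (x * s i))) =
      (w i).coeff (u ^ k * x) - (w i).coeff (u ^ (k + 1) * x) := by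
    have := hm i (u ^ (k + 1) * x)
    simp only [pow_succ', mul_assoc, of_apply, Pi.smul_apply, smul_eq_mul, sub_mul, one_mul,
      coeff_sub, Finsupp.coe_sub, Pi.sub_apply, coeff_single_mul_apply, inv_mul_cancel_left,
      sub_sub_sub_cancel_left] at this ⊢
    linarith
  rw [← hx, ← hxs, ← Finset.sum_sub_distrib, Finset.sum_congr rfl fun k _ => hterm k,
    Finset.sum_range_sub', hn]
  simp

theorem one_sub_inv_mem_coboundaries (s : ι → G) :
    (fun i => 1 - of ℤ G (s i)⁻¹) ∈ coboundaries s := by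
  classical
  refine ⟨Pi.single 1 1, fun i x => ?_⟩
  simp [one_def, Pi.single_apply, Finsupp.single_apply, mul_eq_one_iff_inv_eq', eq_comm]

theorem mem_coboundaries_of_outBoundary_eq {s : ι → G} {A T : Set G} [DecidablePred (· ∈ T)]
    (hA : outBoundary (mulCayley (Set.range s)) A = {1} ×ˢ T) :
    (fun i => (if s i ∈ T then 1 else 0) - if (s i)⁻¹ ∈ T then of ℤ G (s i)⁻¹ else 0) ∈
      coboundaries s := by
  classical
  refine ⟨A.indicator 1, fun i x => ?_⟩
  have hout : x ∈ A ∧ x * s i ∉ A ↔ x = 1 ∧ s i ∈ T := by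
    have hadj : ∃ j, s j = s i ∨ x = x * s i * s j := ⟨i, .inl rfl⟩
    have h : x ∈ A ∧ x * s i ∉ A ↔ x = 1 ∧ x * s i ∈ T := by
      simpa [mem_outBoundary_mulCayley, hadj] using Set.ext_iff.1 hA (x, x * s i)
    rw [h]
    exact and_congr_right fun hx => by rw [hx, one_mul]
  have hin : x * s i ∈ A ∧ x ∉ A ↔ x = (s i)⁻¹ ∧ (s i)⁻¹ ∈ T := by
    have hadj : ∃ j, x * s i * s j = x ∨ s i = s j := ⟨i, .inr rfl⟩
    have h : x * s i ∈ A ∧ x ∉ A ↔ x * s i = 1 ∧ x ∈ T := by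
      simpa [mem_outBoundary_mulCayley, hadj] using Set.ext_iff.1 hA (x * s i, x)
    rw [h, mul_eq_one_iff_eq_inv]
    exact and_congr_right fun hx => by rw [hx]
  have hcoeff (u y : G) (P : Prop) [Decidable P] :
      (if P then of ℤ G u else 0 : ℤ[G]).coeff y = if y = u ∧ P then 1 else 0 := by
    split_ifs <;> simp_all [eq_comm]
  rw [← map_one (of ℤ G), coeff_sub, Finsupp.sub_apply, hcoeff, hcoeff,
    if_congr hout.symm rfl rfl, if_congr hin.symm rfl rfl]
  by_cases h₁ : x ∈ A <;> by_cases h₂ : x * s i ∈ A <;> simp [h₁, h₂]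

end Coboundaries

section FreePairs

variable {G : Type*} [Group G] {g k : G}

theorem closure_pair_eq_top_of_mem {h : G} (hgen : Subgroup.closure {g, h} = ⊤)
    (hh : h ∈ Subgroup.closure {g, k}) : Subgroup.closure {g, k} = ⊤ := by
  rw [eq_top_iff, ← hgen, Subgroup.closure_le, Set.pair_subset_iff]
  exact ⟨Subgroup.subset_closure (Set.mem_insert g {k}), hh⟩

theorem closure_pair_inv_eq_top {h : G} (hgen : Subgroup.closure {g, h} = ⊤) :
    Subgroup.closure {g, h⁻¹} = ⊤ :=
  closure_pair_eq_top_of_mem hgen (inv_mem_iff.1 (Subgroup.subset_closure (by simp)))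

theorem isFreePair_conj {Y : Set G} (hgen : Subgroup.closure {g, k} = ⊤) (hne : k ≠ 1)
    (h₁ : 1 ∈ Y) (hg : ∀ x, x * g ∈ Y ↔ x ∈ Y ∧ x ≠ 1) (hk : ∀ x, x * k ∈ Y ↔ x ∈ Y) :
    IsFreePair g (k * g * k⁻¹) := by
  let k' : Subgroup.zpowers k := ⟨k, Subgroup.mem_zpowers k⟩
  have hk' : 1 ≠ k' := fun h => hne (congrArg Subtype.val h).symm
  have : Nontrivial (Subgroup.zpowers k) := ⟨1, k', hk'⟩
  have hgen' : Subgroup.closure (insert g (Subgroup.zpowers k : Set G)) = ⊤ :=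
    top_le_iff.1 <| hgen ▸ Subgroup.closure_mono
      (Set.insert_subset_insert (Set.singleton_subset_iff.2 k'.2))
  have hzpowers : ∀ u ∈ Subgroup.zpowers k, ∀ x, x * u ∈ Y ↔ x ∈ Y := by
    intro u hu
    rw [Subgroup.zpowers_eq_closure] at hu
    induction hu using Subgroup.closure_induction with
    | mem u hu => exact hu ▸ hk
    | one => simp
    | mul u v _ _ hu hv => exact fun x => by rw [← mul_assoc, hv, hu]
    | inv u _ hu => exact fun x => by rw [← hu, inv_mul_cancel_right]
  have hinj : Function.Injective ![1, k'] := by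
    simpa [Fin.cons_injective_iff] using hk'
  have hlift : FreeGroup.lift ![g, k * g * k⁻¹] =
      (FreeGroup.lift fun u : Subgroup.zpowers k => (u : G) * g * (u : G)⁻¹).comp
        (FreeGroup.map ![1, k']) := by
    ext i
    fin_cases i <;> simp [k']
  rw [IsFreePair, hlift]
  exact (injective_lift_conj hgen' h₁ hg hzpowers).comp (FreeGroup.map_injective hinj)

open MonoidAlgebra

theorem isFreePair_conj_of_height {N : G → ℤ} (hgen : Subgroup.closure {g, k} = ⊤) (hne : k ≠ 1)
    (hg : ∀ x, N x - N (x * g) = (1 : ℤ[G]).coeff x) (hk : ∀ x, N (x * k) = N x) :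
    IsFreePair g (k * g * k⁻¹) := by
  refine isFreePair_conj (Y := {x | N 1 ≤ N x}) hgen hne (le_refl (N 1)) (fun x => ?_)
    fun x => by simp [hk]
  obtain rfl | hx := eq_or_ne x 1
  · have : N 1 - N g = 1 := by simpa [one_def] using hg 1
    simpa using (by lia : N g < N 1)
  · have : N x - N (x * g) = 0 := by simp [hg, one_def, hx]
    simp [sub_eq_zero.1 this, hx]

theorem isFreePair_of_mem_coboundaries {h : G} (hgen : Subgroup.closure {g, h} = ⊤) (hh : h ≠ 1)
    (hgh : g ≠ h) (hN : ![1, 0] ∈ coboundaries ![g, h] ∨ ![1, 1] ∈ coboundaries ![g, h]) :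
    IsFreePair g (h⁻¹ * g * h) := by
  obtain ⟨N, hN⟩ | ⟨N, hN⟩ := hN
  · have hNh (x : G) : N x = N (x * h) := by simpa [sub_eq_zero] using hN 1 x
    simpa using isFreePair_conj_of_height (closure_pair_inv_eq_top hgen) (inv_ne_one.2 hh) (hN 0)
      fun x => by rw [hNh, inv_mul_cancel_right]
  · have hNgh (x : G) : N (x * g) = N (x * h) :=
      sub_right_injective ((hN 0 x).trans (hN 1 x).symm)
    have hgen' : Subgroup.closure {g, h⁻¹ * g} = ⊤ := closure_pair_eq_top_of_mem hgen <| by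
      simpa using mul_mem (Subgroup.subset_closure (Set.mem_insert g {h⁻¹ * g}))
        (inv_mem (Subgroup.subset_closure (Set.mem_insert_of_mem g rfl)))
    have := isFreePair_conj_of_height hgen' (by simpa [inv_mul_eq_one] using hgh.symm) (hN 0)
      fun x => by rw [← mul_assoc, hNgh, inv_mul_cancel_right]
    simpa [mul_assoc] using this

end FreePairs

section SierpinskiCuts

open MonoidAlgebra
open SimpleGraph (mulCayley)

variable {G : Type*} [Group G] {g h d : G} {F : Set G}

/-- Right multiplication by `g` removes exactly the point `1` from `F`, and right multiplication
by `h` exactly the point `d ≠ 1`. If `gE = E ∖ {a}` and `hE = E ∖ {b}`, then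
`F = {x | x⁻¹a ∈ E}` is such a set with `d = ab⁻¹`. -/
structure IsSierpinskiCut (g h d : G) (F : Set G) : Prop where
  one_mem : 1 ∈ F
  mem : d ∈ F
  ne_one : d ≠ 1
  mul_fst_mem_iff : ∀ x, x * g ∈ F ↔ x ∈ F ∧ x ≠ 1
  mul_snd_mem_iff : ∀ x, x * h ∈ F ↔ x ∈ F ∧ x ≠ d

theorem not_isOfFinOrder_of_mul_mem {u x : G} (hF : ∀ y, y * u ∈ F → y ∈ F) (hx : x ∈ F)
    (hxu : x * u ∉ F) : ¬IsOfFinOrder u := by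
  rw [isOfFinOrder_iff_pow_eq_one]
  rintro ⟨n, hn, hun⟩
  have not_mem (m : ℕ) : x * u ^ (m + 1) ∉ F := by
    induction m with
    | zero => simpa using hxu
    | succ m ih => exact fun h => ih (hF _ (by rwa [mul_assoc, ← pow_succ]))
  obtain ⟨m, rfl⟩ := Nat.exists_eq_succ_of_ne_zero hn.ne'
  exact not_mem m (by rwa [hun, mul_one])

theorem ne_inv_of_not_isOfFinOrder {u : G} (hu : ¬IsOfFinOrder u) : u ≠ u⁻¹ := fun h =>
  hu (isOfFinOrder_iff_pow_eq_one.2 ⟨2, two_pos, by rw [pow_two, mul_eq_one_iff_eq_inv, ← h]⟩)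

namespace IsSierpinskiCut

theorem fst_notMem (hF : IsSierpinskiCut g h d F) : g ∉ F := by
  simpa using hF.mul_fst_mem_iff 1

theorem not_isOfFinOrder_fst (hF : IsSierpinskiCut g h d F) : ¬IsOfFinOrder g :=
  not_isOfFinOrder_of_mul_mem (fun y hy => ((hF.mul_fst_mem_iff y).1 hy).1) hF.one_mem
    (by simpa using hF.fst_notMem)

theorem not_isOfFinOrder_snd (hF : IsSierpinskiCut g h d F) : ¬IsOfFinOrder h :=
  not_isOfFinOrder_of_mul_mem (fun y hy => ((hF.mul_snd_mem_iff y).1 hy).1) hF.mem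
    (by simp [hF.mul_snd_mem_iff])

theorem not_isOfFinOrder_mul (hF : IsSierpinskiCut g h d F) : ¬IsOfFinOrder (g * h) := by
  refine not_isOfFinOrder_of_mul_mem (F := F) (x := 1) (fun y hy => ?_) hF.one_mem ?_
  · rw [← mul_assoc, hF.mul_snd_mem_iff, hF.mul_fst_mem_iff] at hy
    exact hy.1.1
  · simp [hF.mul_snd_mem_iff, hF.fst_notMem]

theorem fst_ne_snd (hF : IsSierpinskiCut g h d F) : g ≠ h := by
  rintro rfl
  have := (hF.mul_fst_mem_iff 1).symm.trans (hF.mul_snd_mem_iff 1)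
  simp [hF.one_mem, hF.ne_one.symm] at this

theorem outBoundary_eq (hF : IsSierpinskiCut g h d F) :
    outBoundary (mulCayley {g, h}) F = {(1, g), (d, d * h)} := by
  ext ⟨x, y⟩
  rw [mem_outBoundary_mulCayley_of_mul_mem]
  · constructor
    · rintro ⟨hx, hy, s, rfl | rfl, rfl⟩
      · obtain rfl : x = 1 := by simpa [hF.mul_fst_mem_iff, hx] using hy
        simp
      · obtain rfl : x = d := by simpa [hF.mul_snd_mem_iff, hx] using hy
        simp
    · rintro (h | h) <;> cases h
      · exact ⟨hF.one_mem, by simpa using hF.mul_fst_mem_iff 1, g, by simp⟩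
      · exact ⟨hF.mem, by simp [hF.mul_snd_mem_iff], h, by simp⟩
  · rintro s (rfl | rfl) x hx
    · exact ((hF.mul_fst_mem_iff x).1 hx).1
    · exact ((hF.mul_snd_mem_iff x).1 hx).1

theorem exists_outBoundary_eq (hF : IsSierpinskiCut g h d F)
    (hgen : Subgroup.closure {g, h} = ⊤) :
    ∃ A, ∃ s ∈ ({g, g⁻¹, h, h⁻¹} : Set G), ∃ t ∈ ({g, g⁻¹, h, h⁻¹} : Set G),
      outBoundary (mulCayley {g, h}) A = {1} ×ˢ {s, t} := by
  have hcut : ∀ s ∈ ({g, h} : Set G), ∃ B x z z',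
      outBoundary (mulCayley {g, h}) B = {(x, x * s), (z, z')} := by
    rintro _ (rfl | hs)
    · exact ⟨F, 1, d, d * h, by rw [one_mul, hF.outBoundary_eq]⟩
    · exact ⟨F, d, 1, g, by rw [Set.mem_singleton_iff.1 hs, hF.outBoundary_eq, Set.pair_comm]⟩
  obtain ⟨A, s, t, hA⟩ :=
    exists_outBoundary_mulCayley_eq_one_prod_pair hgen ⟨g, Set.mem_insert g {h}⟩ hcut
  have mem_gens {s : G} (hs : (1, s) ∈ outBoundary (mulCayley {g, h}) A) :
      s ∈ ({g, g⁻¹, h, h⁻¹} : Set G) := by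
    have := (mem_outBoundary_mulCayley.1 hs).2.2
    simp only [Set.mem_insert_iff, Set.mem_singleton_iff, exists_eq_or_imp, exists_eq_left,
      one_mul, eq_comm (a := (1 : G)), mul_eq_one_iff_eq_inv, eq_comm (b := s)] at this ⊢
    tauto
  exact ⟨A, s, mem_gens (by simp [hA]), t, mem_gens (by simp [hA]), hA⟩

theorem vec_one_of_mem_coboundaries (hF : IsSierpinskiCut g h d F) :
    ![1, of ℤ G d] ∈ coboundaries ![g, h] := by
  classical
  refine ⟨F.indicator 1, fun i x => ?_⟩
  have := hF.one_mem
  have := hF.mem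
  have := hF.fst_notMem
  fin_cases i
  · by_cases hx : x ∈ F <;> by_cases h₁ : x = 1 <;>
      simp_all [one_def, hF.mul_fst_mem_iff]
  · by_cases hx : x ∈ F <;> by_cases h₁ : x = d <;>
      simp_all [hF.mul_snd_mem_iff]

-- The vectors are the coboundaries of a set whose boundary is `{1} ×ˢ T`, for the possible `T`.
theorem exists_mem_coboundaries (hF : IsSierpinskiCut g h d F)
    (hgen : Subgroup.closure {g, h} = ⊤) :
    ∃ w ∈ coboundaries ![g, h], w ∈ ({![1, 0], ![-of ℤ G g⁻¹, 0], ![0, 1], ![0, -of ℤ G h⁻¹],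
      ![1, 1], ![-of ℤ G g⁻¹, -of ℤ G h⁻¹], ![1 - of ℤ G g⁻¹, 0], ![0, 1 - of ℤ G h⁻¹],
      ![1, -of ℤ G h⁻¹], ![-of ℤ G g⁻¹, 1]} : Set (Fin 2 → ℤ[G])) := by
  classical
  obtain ⟨A, s, hs, t, ht, hA⟩ := hF.exists_outBoundary_eq hgen
  have hrange : Set.range ![g, h] = {g, h} := by simp [Set.pair_comm]
  rw [← hrange] at hA
  refine ⟨_, mem_coboundaries_of_outBoundary_eq hA, ?_⟩
  have h₁ := hF.fst_ne_snd
  have h₂ : g ≠ g⁻¹ := ne_inv_of_not_isOfFinOrder hF.not_isOfFinOrder_fst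
  have h₃ : h ≠ h⁻¹ := ne_inv_of_not_isOfFinOrder hF.not_isOfFinOrder_snd
  have h₄ : g ≠ h⁻¹ := fun e => hF.not_isOfFinOrder_mul (by simp [e])
  have h₅ : h ≠ g⁻¹ := fun e => hF.not_isOfFinOrder_mul (by simp [e])
  have eq_vec (f : Fin 2 → ℤ[G]) : f = ![f 0, f 1] := by
    ext i : 1
    fin_cases i <;> rfl
  rw [eq_vec fun _ => _]
  clear hA hrange hgen hF
  rcases hs with rfl | rfl | rfl | rfl <;> rcases ht with rfl | rfl | rfl | rfl <;>
    simp [h₁, h₂, h₃, h₄, h₅, h₁.symm, h₂.symm, h₃.symm, h₄.symm, h₅.symm]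

theorem one_zero_mem_or_one_one_mem_coboundaries (hF : IsSierpinskiCut g h d F)
    (hgen : Subgroup.closure {g, h} = ⊤) :
    ![1, 0] ∈ coboundaries ![g, h] ∨ ![1, 1] ∈ coboundaries ![g, h] := by
  obtain ⟨w, hw, hcases⟩ := hF.exists_mem_coboundaries hgen
  have hd := hF.vec_one_of_mem_coboundaries
  have hδ := one_sub_inv_mem_coboundaries ![g, h]
  have hdiv {u : G} (hu : ¬IsOfFinOrder u) :=
    mem_coboundaries_of_one_sub_smul_mem (s := ![g, h]) (by simpa [Set.pair_comm] using hgen) hu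
      (w := ![1, 0])
  set Ω := coboundaries ![g, h]
  have compl {v w : ℤ[G]} (hvw : ![v, w] ∈ Ω) :
      ![1 - of ℤ G g⁻¹ - v, 1 - of ℤ G h⁻¹ - w] ∈ Ω := by
    convert Ω.sub_mem hδ hvw using 1
    ext i : 1
    fin_cases i <;> rfl
  have of_snd (hw : ![0, 1] ∈ Ω) : ![1, 0] ∈ Ω := by
    simpa [Matrix.smul_cons] using Ω.add_mem hd (Ω.smul_mem (-of ℤ G d) hw)
  have of_fst_fst_inv (hw : ![1 - of ℤ G g⁻¹, 0] ∈ Ω) : ![1, 0] ∈ Ω :=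
    hdiv (u := g⁻¹) (by simpa using hF.not_isOfFinOrder_fst) (by simpa using hw)
  have of_fst_snd_inv (hw : ![1, -of ℤ G h⁻¹] ∈ Ω) : ![1, 0] ∈ Ω := by
    refine hdiv (u := (g * h)⁻¹) (isOfFinOrder_inv_iff.not.2 hF.not_isOfFinOrder_mul) ?_
    simpa [sub_eq_add_neg, mul_add] using Ω.add_mem hw (Ω.smul_mem (of ℤ G h⁻¹) (compl hw))
  obtain rfl | rfl | rfl | rfl | rfl | rfl | rfl | rfl | rfl | rfl := hcases
  · exact .inl hw
  · exact .inl (by simpa [one_def] using Ω.smul_mem (-of ℤ G g) hw)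
  · exact .inl (of_snd hw)
  · exact .inl (of_snd (by simpa [one_def] using Ω.smul_mem (-of ℤ G h) hw))
  · exact .inr hw
  · exact .inr (by simpa using compl hw)
  · exact .inl (of_fst_fst_inv hw)
  · exact .inl (of_fst_fst_inv (by simpa using compl hw))
  · exact .inl (of_fst_snd_inv hw)
  · exact .inl (of_fst_snd_inv (by simpa using compl hw))

theorem isFreePair (hF : IsSierpinskiCut g h d F) (hgen : Subgroup.closure {g, h} = ⊤) :
    IsFreePair g (h⁻¹ * g * h) :=
  isFreePair_of_mem_coboundaries hgen (by rintro rfl; exact hF.not_isOfFinOrder_snd .one)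
    hF.fst_ne_snd (hF.one_zero_mem_or_one_one_mem_coboundaries hgen)

end IsSierpinskiCut

end SierpinskiCuts

section WeakSierpinskiSubsets

variable {G : Type*} [Group G] {g h : G} {E : Set G}

theorem inv_mul_mem_iff_of_smul_eq_diff {c d : G} (hc : c • E = E \ {d}) (x a : G) :
    (x * c)⁻¹ * a ∈ E ↔ x⁻¹ * a ∈ E ∧ x⁻¹ * a ≠ d := by
  rw [← Set.smul_mem_smul_set_iff (a := c), hc]
  simp [mul_assoc]

theorem closure_fstGen_sndGen (g h : G) : Subgroup.closure {fstGen g h, sndGen g h} = ⊤ := by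
  have := Subgroup.closure_closure_coe_preimage (k := ({g, h} : Set G))
  convert this using 2
  ext x
  simp [fstGen, sndGen, Subtype.ext_iff]

theorem isFreePair_of_isWeakSierpinskiWith (hE : IsWeakSierpinskiWith g h E) :
    IsFreePair (fstGen g h) ((sndGen g h)⁻¹ * fstGen g h * sndGen g h) := by
  obtain ⟨a, ha, b, hb, hab, hgE, hhE⟩ := hE
  have hgen := closure_fstGen_sndGen g h
  let F : Set (Subgroup.closure {g, h}) := {x | (x : G)⁻¹ * a ∈ E}
  have h₁ : 1 ∈ F := by simpa [F] using ha
  have hg (x) : x * fstGen g h ∈ F ↔ x ∈ F ∧ x ≠ 1 := by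
    simpa [F, fstGen] using inv_mul_mem_iff_of_smul_eq_diff hgE x a
  have hh (x) : x * sndGen g h ∈ F ↔ x ∈ F ∧ (x : G)⁻¹ * a ≠ b := by
    simpa [F, sndGen] using inv_mul_mem_iff_of_smul_eq_diff hhE x a
  by_cases hd : ∃ d : Subgroup.closure {g, h}, (d : G)⁻¹ * a = b
  · obtain ⟨d, rfl⟩ := hd
    have hF : IsSierpinskiCut (fstGen g h) (sndGen g h) d F :=
      ⟨h₁, hb, by rintro rfl; simp at hab, hg, fun x => by simp [hh]⟩
    exact hF.isFreePair hgen
  · have hsnd : sndGen g h ≠ 1 := by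
      intro hone
      obtain rfl : h = 1 := congrArg Subtype.val hone
      exact (hhE.subset (by simpa using hb)).2 rfl
    have hinv (x) : x * (sndGen g h)⁻¹ ∈ F ↔ x ∈ F := by
      have := hh (x * (sndGen g h)⁻¹)
      rw [inv_mul_cancel_right, and_iff_left (not_exists.1 hd _)] at this
      exact this.symm
    simpa using isFreePair_conj (closure_pair_inv_eq_top hgen) (inv_ne_one.2 hsnd) h₁ hg hinv

theorem IsFreePair.coe {H : Subgroup G} {x y : H} (hxy : IsFreePair x y) :
    IsFreePair (x : G) (y : G) := by
  have hcomp : FreeGroup.lift ![(x : G), (y : G)] =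
      H.subtype.comp (FreeGroup.lift ![x, y]) := by
    ext i
    fin_cases i <;> simp
  rw [IsFreePair, hcomp]
  exact H.subtype_injective.comp hxy

end WeakSierpinskiSubsets

theorem corollary1 {G : Type*} [Group G] :
    ((∃ E : Set G, IsWeakSierpinski E) → ∃ F : Subgroup G, IsFreeOfRankTwo F) ∧
    (∀ (g h : G) (E : Set G), IsWeakSierpinskiWith g h E →
      IsFreePair (fstGen g h) ((sndGen g h)⁻¹ * fstGen g h * sndGen g h)) := by
  refine ⟨?_, fun g h E hE => isFreePair_of_isWeakSierpinskiWith hE⟩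
  rintro ⟨E, g, h, hE⟩
  have hfree := (isFreePair_of_isWeakSierpinskiWith hE).coe
  exact ⟨_, ⟨(MonoidHom.ofInjective hfree).symm⟩⟩
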